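/- **Setting.** Let $d\ge 1$. Fix an orthonormal wavelet basis $\{\psi_\lambda\}_{\lambda\in\Lambda}$ of the real space $L_2(\mathbb R^d)$ consisting of the integer translates $\varphi(\cdot-k)$ of a scaling function (scale $|\lambda|=0$) and of the functions $2^{jd/2}\psi_e(2^j\cdot-k)$, $j\ge 0$, $k\in\mathbb Z^d$, $1\le e\le 2^d-1$ (scale $|\lambda|=j$), where $\varphi,\psi_e$ are real Schwartz functions and all moments of the $\psi_e$ vanish (e.g. the Lemarié–Meyer basis). For a real tempered distribution $u$ put $u_\lambda=\langle u,\psi_\lambda\rangle$. For $s\in\mathbb R$, $0<p<\infty$, the Besov space $B^s_p=B^s_{p,p}$ consists of the tempered distributions $u$ with finite (quasi-)norm $$\|u\|_{B^s_p}=\Big(\sum_{\lambda}2^{p(s+d(\frac12-\frac1p))|\lambda|}\,|u_\lambda|^p\Big)^{1/p},$$ and $\|u\|_{B^s_p}=\infty$ for $u\notin B^s_p$; $H^\sigma=B^\sigma_2$. Write $\mathcal B_X=B^{s_X}_{p_X}$ for $X\in\{D,S,G,R\}$, with $s_D,s_S,s_G\in\mathbb R$, $p_D>1$, $p_S,p_G>0$;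 $s_R,p_R$ are specified below. Let $F:\mathcal B_D\to L_2(\mathbb R^d)$ be linear and continuous, with adjoint $F^*:L_2(\mathbb R^d)\to\mathcal B_D^*$. Assume that $\mathcal B_G\subset\mathcal B_D^*$ continuously, and that $\mathcal B_G\subset\operatorname{rg}F^*$ (in particular this holds if $\operatorname{rg}F^*=\mathcal B_G$). Here a functional $\xi\in\mathcal B_D^*$ is identified with its wavelet coefficients $\xi_\lambda=\xi(\psi_\lambda)$. **Theorem.** Let $\mathcal B_S\subset\mathcal B_D$, $p_S\le p_G$, $u^\dagger\in\mathcal B_S$ and $v=Fu^\dagger$. Let $p>0$ with $p_S\le p\le\min\{p_D,p_G\}$, let $\varepsilon>0$, and let $$p_R=\frac{p+p_G}{p_G},\qquad s_R\le\frac{p\,s_S-p_Gs_G}{p+p_G}-d\,\frac{1}{p+p_G}\Big(\frac p{p_S}-1\Big)-\varepsilon\Big(\frac p{p_S}-1\Big),\qquad \sigma=s_R+d\Big(\frac12-\frac1{p_R}\Big).$$ Then for all constants $c_1,c_2>0$ there are $K,\delta_0>0$ such that for every $0<\delta\le\delta_0$, every $\alpha$ with $c_1\delta\le\alpha\le c_2\delta$,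 every $v^\delta\in L_2(\mathbb R^d)$ with $\|v-v^\delta\|_{L_2}\le\delta$, and every minimizer $u^{\alpha,\delta}$ over $\mathcal B_D$ of the Tikhonov functional $$T_\alpha(u)=\|Fu-v^\delta\|_{L_2}^2+\alpha\,\|u\|_{\mathcal B_R}^{p_R}\in[0,\infty],$$ one has $\|u^{\alpha,\delta}-u^\dagger\|_{H^\sigma}\le K\sqrt\delta$. That is, $\|u^{\alpha,\delta}-u^\dagger\|_{H^\sigma}=\mathcal O(\sqrt\delta)$ as $\delta\to0$ under the rule $\alpha\asymp\delta$. -/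

import Mathlib

open MeasureTheory
open scoped NNReal ENNReal SchwartzMap

noncomputable section

namespace BesovTikhonov

/-- Euclidean space `ℝ^d`. -/
abbrev Space (d : ℕ) : Type := EuclideanSpace ℝ (Fin d)

/-- Real tempered distributions on `ℝ^d`. -/
abbrev Tempered (d : ℕ) : Type := 𝓢(Space d, ℝ) →L[ℝ] ℝ

/-- The real Lebesgue space `L_2(ℝ^d)`. -/
abbrev L2 (d : ℕ) : Type := Lp ℝ 2 (volume : Measure (Space d))

/-- The regular tempered distribution `φ ↦ ∫ f φ` given by a Schwartz function `f`. -/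
def ofSchwartz {d : ℕ} (f : 𝓢(Space d, ℝ)) : Tempered d :=
  (SchwartzMap.integralCLM ℝ (volume : Measure (Space d))) ∘L
    (SchwartzMap.pairing (ContinuousLinearMap.mul ℝ ℝ) f)

/-- Wavelet indices `λ`: integer translates of the scaling function (`Sum.inl k`), and
`Sum.inr (j, e, k)` for the `e`-th mother wavelet at scale `j` and position `k`. -/
abbrev Index (d : ℕ) : Type :=
  (Fin d → ℤ) ⊕ (ℕ × Fin (2 ^ d - 1) × (Fin d → ℤ))

/-- The scale `|λ|` of a wavelet index. -/
def Index.level {d : ℕ} : Index d → ℕ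
  | Sum.inl _ => 0
  | Sum.inr (j, _, _) => j

/-- The dilation `x ↦ 2^j x` of `ℝ^d`. -/
def dyadicScale (d j : ℕ) : Space d ≃L[ℝ] Space d :=
  ContinuousLinearEquiv.smulLeft (Units.mk0 ((2 : ℝ) ^ j) (by positivity))

/-- The function `x ↦ 2^{jd/2} f(2^j x - k)`; see `dyadic_apply`. -/
def dyadic {d : ℕ} (f : 𝓢(Space d, ℝ)) (j : ℕ) (k : Fin d → ℤ) : 𝓢(Space d, ℝ) :=
  ((2 : ℝ) ^ ((j : ℝ) * d / 2)) •
    SchwartzMap.compCLMOfContinuousLinearEquiv ℝ (dyadicScale d j)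
      (SchwartzMap.compSubConstCLM ℝ (WithLp.toLp 2 fun i => (k i : ℝ)) f)

theorem dyadic_apply {d : ℕ} (f : 𝓢(Space d, ℝ)) (j : ℕ) (k : Fin d → ℤ) (x : Space d) :
    dyadic f j k x = (2 : ℝ) ^ ((j : ℝ) * d / 2) *
      f ((2 : ℝ) ^ j • x - WithLp.toLp 2 fun i => (k i : ℝ)) := rfl

/-- The system generated by a scaling function and mother wavelets: all integer translates of the
scaling function and all the functions `2^{jd/2} ψ_e(2^j x - k)` with `j ≥ 0`. -/
def waveletSystem {d : ℕ} (father : 𝓢(Space d, ℝ)) (mother : Fin (2 ^ d - 1) → 𝓢(Space d, ℝ)) :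
    Index d → 𝓢(Space d, ℝ)
  | Sum.inl k => dyadic father 0 k
  | Sum.inr (j, e, k) => dyadic (mother e) j k

/-- A (smooth, rapidly decaying) orthonormal wavelet basis of `L_2(ℝ^d)`, for example the
Lemarié–Meyer basis: scaling function and mother wavelets are Schwartz functions, all moments of
the mother wavelets vanish, and the generated system is an orthonormal basis. Such a basis
characterizes the Besov spaces `B^s_{p,p}` of all orders `s` and all exponents `0 < p < ∞`. -/
structure WaveletBasis (d : ℕ) where
  father : 𝓢(Space d, ℝ)
  mother : Fin (2 ^ d - 1) → 𝓢(Space d, ℝ)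
  moments : ∀ (e : Fin (2 ^ d - 1)) (a : Fin d → ℕ),
    ∫ x : Space d, (∏ i, x i ^ a i) * mother e x = 0
  orthonormal : ∀ l m : Index d,
    ∫ x : Space d, waveletSystem father mother l x * waveletSystem father mother m x =
      if l = m then 1 else 0
  complete : ∀ f : L2 d,
    (∀ l : Index d, ∫ x : Space d, f x * waveletSystem father mother l x = 0) → f = 0

namespace WaveletBasis

variable {d : ℕ} (W : WaveletBasis d)

/-- The basis function `ψ_λ`. -/
def psi (l : Index d) : 𝓢(Space d, ℝ) := waveletSystem W.father W.mother l

/-- The wavelet coefficients `u_λ = ⟨u, ψ_λ⟩` of a tempered distribution. -/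
def coeff (u : Tempered d) (l : Index d) : ℝ := u (W.psi l)

theorem coeff_ofSchwartz_psi (l m : Index d) :
    W.coeff (ofSchwartz (W.psi l)) m = if l = m then 1 else 0 :=
  W.orthonormal l m

end WaveletBasis

/-- The wavelet (quasi-)norm of `B^s_p`, as a function of the wavelet coefficients:
`(∑_λ 2^{p (s + d(1/2 - 1/p)) |λ|} |c_λ|^p)^{1/p} ∈ [0,∞]`. -/
def seqNorm {d : ℕ} (s p : ℝ) (c : Index d → ℝ) : ℝ≥0∞ :=
  (∑' l : Index d, ENNReal.ofReal
    ((2 : ℝ) ^ (p * (s + d * (1 / 2 - 1 / p)) * l.level) * |c l| ^ p)) ^ (1 / p)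

theorem seqNorm_lt_top_iff {d : ℕ} {s p : ℝ} (hp : 0 < p) (c : Index d → ℝ) :
    seqNorm s p c < ⊤ ↔ ∑' l : Index d, ENNReal.ofReal
      ((2 : ℝ) ^ (p * (s + d * (1 / 2 - 1 / p)) * l.level) * |c l| ^ p) < ⊤ := by
  unfold seqNorm
  exact ENNReal.rpow_lt_top_iff_of_pos (by positivity)

theorem abs_add_rpow_le {p : ℝ} (hp : 0 < p) (a b : ℝ) :
    |a + b| ^ p ≤ 2 ^ p * (|a| ^ p + |b| ^ p) := by
  have h1 : |a + b| ≤ 2 * max |a| |b| := by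
    have := abs_add_le a b
    have := le_max_left |a| |b|
    have := le_max_right |a| |b|
    linarith
  have h2 : |a + b| ^ p ≤ (2 * max |a| |b|) ^ p :=
    Real.rpow_le_rpow (abs_nonneg _) h1 hp.le
  rw [Real.mul_rpow (by norm_num) (le_max_of_le_left (abs_nonneg _))] at h2
  refine h2.trans (mul_le_mul_of_nonneg_left ?_ (by positivity))
  have ha : 0 ≤ |a| ^ p := by positivity
  have hb : 0 ≤ |b| ^ p := by positivity
  rcases max_cases |a| |b| with h | h <;> rw [h.1] <;> linarith

theorem seqNorm_add_lt_top {d : ℕ} {s p : ℝ} (hp : 0 < p) {a b : Index d → ℝ}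
    (ha : seqNorm s p a < ⊤) (hb : seqNorm s p b < ⊤) :
    seqNorm s p (fun l => a l + b l) < ⊤ := by
  rw [seqNorm_lt_top_iff hp] at *
  refine lt_of_le_of_lt (ENNReal.tsum_le_tsum (g := fun l : Index d =>
    ENNReal.ofReal (2 ^ p) * (ENNReal.ofReal
      ((2 : ℝ) ^ (p * (s + d * (1 / 2 - 1 / p)) * l.level) * |a l| ^ p) + ENNReal.ofReal
      ((2 : ℝ) ^ (p * (s + d * (1 / 2 - 1 / p)) * l.level) * |b l| ^ p))) fun l => ?_) ?_
  · rw [← ENNReal.ofReal_add (by positivity) (by positivity),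
      ← ENNReal.ofReal_mul (by positivity)]
    apply ENNReal.ofReal_le_ofReal
    have h := mul_le_mul_of_nonneg_left (abs_add_rpow_le hp (a l) (b l))
      (show (0 : ℝ) ≤ (2 : ℝ) ^ (p * (s + d * (1 / 2 - 1 / p)) * l.level) by positivity)
    calc _ ≤ _ := h
      _ = _ := by ring
  · rw [ENNReal.tsum_mul_left, ENNReal.tsum_add]
    exact ENNReal.mul_lt_top ENNReal.ofReal_lt_top (ENNReal.add_lt_top.2 ⟨ha, hb⟩)

theorem seqNorm_smul_lt_top {d : ℕ} {s p : ℝ} (hp : 0 < p) (r : ℝ) {a : Index d → ℝ}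
    (ha : seqNorm s p a < ⊤) : seqNorm s p (fun l => r * a l) < ⊤ := by
  rw [seqNorm_lt_top_iff hp] at *
  have h : ∀ l : Index d, ENNReal.ofReal
      ((2 : ℝ) ^ (p * (s + d * (1 / 2 - 1 / p)) * l.level) * |r * a l| ^ p) =
      ENNReal.ofReal (|r| ^ p) * ENNReal.ofReal
      ((2 : ℝ) ^ (p * (s + d * (1 / 2 - 1 / p)) * l.level) * |a l| ^ p) := by
    intro l
    rw [← ENNReal.ofReal_mul (by positivity), abs_mul,
      Real.mul_rpow (abs_nonneg _) (abs_nonneg _)]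
    congr 1
    ring
  rw [tsum_congr h, ENNReal.tsum_mul_left]
  exact ENNReal.mul_lt_top ENNReal.ofReal_lt_top ha

namespace WaveletBasis

variable {d : ℕ} (W : WaveletBasis d)

/-- The Besov (quasi-)norm `‖u‖_{B^s_p} ∈ [0,∞]` of a tempered distribution, with the value `∞`
exactly for `u ∉ B^s_p`. -/
def besovNorm (s p : ℝ) (u : Tempered d) : ℝ≥0∞ := seqNorm s p (W.coeff u)

/-- The Besov space `B^s_p = B^s_{p,p}`, a subspace of the tempered distributions. -/
def besov (s p : ℝ) (hp : 0 < p) : Submodule ℝ (Tempered d) where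
  carrier := {u | W.besovNorm s p u < ⊤}
  add_mem' := fun ha hb => seqNorm_add_lt_top hp ha hb
  zero_mem' := by
    change seqNorm s p (W.coeff 0) < ⊤
    rw [seqNorm_lt_top_iff hp]
    simp [coeff, Real.zero_rpow hp.ne']
  smul_mem' := fun r _ ha => seqNorm_smul_lt_top hp r ha

theorem mem_besov {s p : ℝ} {hp : 0 < p} {u : Tempered d} :
    u ∈ W.besov s p hp ↔ W.besovNorm s p u < ⊤ := Iff.rfl

theorem psi_mem_besov (s p : ℝ) (hp : 0 < p) (l : Index d) :
    ofSchwartz (W.psi l) ∈ W.besov s p hp := by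
  rw [mem_besov, besovNorm, seqNorm_lt_top_iff hp, tsum_eq_single l]
  · exact ENNReal.ofReal_lt_top
  · intro m hm
    simp [coeff_ofSchwartz_psi, hm.symm, Real.zero_rpow hp.ne']

/-- The basis function `ψ_λ` as an element of `B^s_p`. -/
def basisElt (s p : ℝ) (hp : 0 < p) (l : Index d) : W.besov s p hp :=
  ⟨ofSchwartz (W.psi l), W.psi_mem_besov s p hp l⟩

/-- A linear operator `F : B^s_p → L_2` is continuous if it is bounded for the Besov norm. -/
def IsBoundedOp {s p : ℝ} {hp : 0 < p} (F : W.besov s p hp →ₗ[ℝ] L2 d) : Prop :=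
  ∃ C : ℝ≥0, ∀ u : W.besov s p hp, ‖F u‖ₑ ≤ C * W.besovNorm s p u

/-- The dual `(B^s_p)^*`: the linear functionals which are bounded for the Besov norm. -/
def dual (s p : ℝ) (hp : 0 < p) : Set (W.besov s p hp →ₗ[ℝ] ℝ) :=
  {ξ | ∃ C : ℝ≥0, ∀ u : W.besov s p hp, ‖ξ u‖ₑ ≤ C * W.besovNorm s p u}

/-- The continuous embedding `B^{s₁}_{p₁} ⊂ (B^s_p)^*`: each `g ∈ B^{s₁}_{p₁}` acts on `B^s_p` as
a functional `ξ` which extends the action of the distribution `g` on the basis functions, and the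
norm of `ξ` is bounded by a constant times the norm of `g`. -/
def EmbedsInDual (s₁ p₁ : ℝ) (hp₁ : 0 < p₁) (s p : ℝ) (hp : 0 < p) : Prop :=
  ∃ C : ℝ≥0, ∀ g ∈ W.besov s₁ p₁ hp₁, ∃ ξ : W.besov s p hp →ₗ[ℝ] ℝ,
    (∀ l, ξ (W.basisElt s p hp l) = W.coeff g l) ∧
    ∀ u : W.besov s p hp, ‖ξ u‖ₑ ≤ C * W.besovNorm s₁ p₁ g * W.besovNorm s p u

/-- `B^{s₁}_{p₁}` as a subset of `(B^s_p)^*`: the bounded functionals `ξ` whose wavelet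
coefficients `ξ_λ = ξ(ψ_λ)` have finite `B^{s₁}_{p₁}`-norm. -/
def besovInDual (s₁ p₁ s p : ℝ) (hp : 0 < p) : Set (W.besov s p hp →ₗ[ℝ] ℝ) :=
  {ξ | ξ ∈ W.dual s p hp ∧ seqNorm s₁ p₁ (fun l => ξ (W.basisElt s p hp l)) < ⊤}

/-- The adjoint `F^* : L_2 → (B^s_p)^*`, `(F^* w)(u) = ⟨w, F u⟩`. -/
def adjoint {s p : ℝ} {hp : 0 < p} (F : W.besov s p hp →ₗ[ℝ] L2 d) (w : L2 d) :
    W.besov s p hp →ₗ[ℝ] ℝ :=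
  (innerₗ (L2 d) w) ∘ₗ F

theorem adjoint_apply {s p : ℝ} {hp : 0 < p} (F : W.besov s p hp →ₗ[ℝ] L2 d) (w : L2 d)
    (u : W.besov s p hp) : W.adjoint F w u = inner ℝ w (F u) := rfl

/-- The Tikhonov functional `T_α(u) = ‖F u - v^δ‖² + α ‖u‖_{B^{s_R}_{p_R}}^{p_R} ∈ [0,∞]` on
`B^s_p`, the domain of `F`. -/
def tikhonov {s p : ℝ} {hp : 0 < p} (F : W.besov s p hp →ₗ[ℝ] L2 d) (sR pR : ℝ) (vδ : L2 d)
    (α : ℝ) (u : W.besov s p hp) : ℝ≥0∞ :=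
  ‖F u - vδ‖ₑ ^ 2 + ENNReal.ofReal α * W.besovNorm sR pR u ^ pR

/-- `u` minimizes the Tikhonov functional over `B^s_p`. -/
def IsTikhonovMinimizer {s p : ℝ} {hp : 0 < p} (F : W.besov s p hp →ₗ[ℝ] L2 d) (sR pR : ℝ)
    (vδ : L2 d) (α : ℝ) (u : W.besov s p hp) : Prop :=
  ∀ u' : W.besov s p hp, W.tikhonov F sR pR vδ α u ≤ W.tikhonov F sR pR vδ α u'

/-- The norm of the Sobolev space `H^σ = B^σ_{2,2}`. -/
def sobolevNorm (σ : ℝ) (u : Tempered d) : ℝ≥0∞ := W.besovNorm σ 2 u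

end WaveletBasis

end BesovTikhonov

end

/-!
The penalty `‖u‖_{B^{s_R}_{p_R}}^{p_R}` is the `p_R`-th power of the `ℓ_{p_R}`-norm of the weighted
coefficients `x_λ = 2^{σ|λ|} u_λ`, and `1 < p_R ≤ 2`. As `|t| ^ p_R` is strongly convex on bounded
intervals, the Bregman distance of the penalty at `u†` dominates a multiple of
`∑ (x_λ - x†_λ)² = ‖u - u†‖²_{H^σ}` on sets where the penalty is bounded. The `p_R` and `s_R` are
chosen such that the derivative of the penalty at every `u† ∈ B_S` has coefficients in `B_G`, so it
is `F^* w` for some `w`; under this source condition, minimality of `u` bounds the Bregman distance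
by `δ²/α + ‖w‖ δ + α ‖w‖²/4`, which is of order `δ` when `α ≍ δ`.
-/

open Filter Topology

namespace BesovTikhonov

/-! ### Bregman distances -/

theorem modulus_le_of_uniformConvexOn {E : Type*} [NormedAddCommGroup E] [NormedSpace ℝ E]
    {S : Set E} {φ : ℝ → ℝ} {f : E → ℝ} {f' : ℝ} {x y : E} (hf : UniformConvexOn S φ f)
    (hx : x ∈ S) (hy : y ∈ S) (hf' : HasLineDerivAt ℝ f f' x (y - x)) :
    φ ‖y - x‖ ≤ f y - f x - f' := by
  have hslope := hf'.tendsto_slope_zero_right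
  have hbound : Tendsto (fun t : ℝ => f y - f x - (1 - t) * φ ‖y - x‖) (𝓝[>] 0)
      (𝓝 (f y - f x - (1 - 0) * φ ‖y - x‖)) :=
    Continuous.tendsto (by fun_prop) 0 |>.mono_left nhdsWithin_le_nhds
  have hle : ∀ᶠ t : ℝ in 𝓝[>] 0,
      t⁻¹ • (f (x + t • (y - x)) - f x) ≤ f y - f x - (1 - t) * φ ‖y - x‖ := by
    filter_upwards [Ioo_mem_nhdsGT zero_lt_one] with t ⟨ht0, ht1⟩
    have hconv := hf.2 hy hx ht0.le (sub_nonneg.2 ht1.le) (add_sub_cancel t 1)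
    rw [show t • y + (1 - t) • x = x + t • (y - x) by module] at hconv
    simp only [smul_eq_mul] at hconv ⊢
    rw [inv_mul_le_iff₀ ht0]
    linarith
  linarith [le_of_tendsto_of_tendsto hslope hbound hle]

theorem summable_modulus_and_tsum_modulus_le {ι E : Type*} [NormedAddCommGroup E]
    [NormedSpace ℝ E] {S : Set E} {φ : ℝ → ℝ} {f : E → ℝ} {f' : ι → ℝ} {x y : ι → E}
    (hf : UniformConvexOn S φ f) (hφ : ∀ r, 0 ≤ φ r) (hx : ∀ i, x i ∈ S) (hy : ∀ i, y i ∈ S)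
    (hf' : ∀ i, HasLineDerivAt ℝ f (f' i) (x i) (y i - x i))
    (hfx : Summable fun i => f (x i)) (hfy : Summable fun i => f (y i)) (hf's : Summable f') :
    (Summable fun i => φ ‖y i - x i‖) ∧
      ∑' i, φ ‖y i - x i‖ ≤ ∑' i, f (y i) - ∑' i, f (x i) - ∑' i, f' i := by
  have hle i : φ ‖y i - x i‖ ≤ f (y i) - f (x i) - f' i :=
    modulus_le_of_uniformConvexOn hf (hx i) (hy i) (hf' i)
  have hbreg := (hfy.sub hfx).sub hf's
  have hsum : Summable fun i => φ ‖y i - x i‖ :=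
    Summable.of_nonneg_of_le (fun i => hφ _) hle hbreg
  refine ⟨hsum, ?_⟩
  rw [← hfy.tsum_sub hfx, ← (hfy.sub hfx).tsum_sub hf's]
  exact hsum.tsum_le_tsum hle hbreg

theorem hasDerivAt_rpow_sub_mul_sq {q c t : ℝ} (ht : t ≠ 0) :
    HasDerivAt (fun t : ℝ => t ^ q - c * t ^ 2) (q * t ^ (q - 1) - 2 * c * t) t :=
  ((Real.hasDerivAt_rpow_const (Or.inl ht)).sub ((hasDerivAt_pow 2 t).const_mul c)).congr_deriv
    (by push_cast; ring)

theorem convexOn_rpow_sub_mul_sq {q : ℝ} (hq : 1 ≤ q) (hq2 : q ≤ 2) (M : ℝ) :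
    ConvexOn ℝ (Set.Icc 0 M) fun t => t ^ q - q * (q - 1) / 2 * M ^ (q - 2) * t ^ 2 := by
  set c := q * (q - 1) / 2 * M ^ (q - 2) with hc
  refine convexOn_of_hasDerivWithinAt2_nonneg (convex_Icc 0 M)
    (f' := fun t => q * t ^ (q - 1) - 2 * c * t)
    (f'' := fun t => q * ((q - 1) * t ^ (q - 1 - 1)) - 2 * c) ?_ ?_ ?_ ?_
  · exact ((Real.continuous_rpow_const (zero_le_one.trans hq)).sub (by fun_prop)).continuousOn
  all_goals
    rw [interior_Icc]
    rintro t ⟨ht0, htM⟩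
  · exact (hasDerivAt_rpow_sub_mul_sq ht0.ne').hasDerivWithinAt
  · exact (((Real.hasDerivAt_rpow_const (Or.inl ht0.ne')).const_mul q).sub
      (((hasDerivAt_id t).const_mul (2 * c)).congr_deriv (mul_one _))).hasDerivWithinAt
  · have hpow : M ^ (q - 2) ≤ t ^ (q - 2) :=
      Real.rpow_le_rpow_of_nonpos ht0 htM.le (by linarith)
    have hcoef : 0 ≤ q * (q - 1) := mul_nonneg (by linarith) (by linarith)
    rw [hc, show q - 1 - 1 = q - 2 by ring]
    linarith [mul_le_mul_of_nonneg_left hpow hcoef]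

theorem monotoneOn_rpow_sub_mul_sq {q : ℝ} (hq : 1 ≤ q) (hq2 : q ≤ 2) (M : ℝ) :
    MonotoneOn (fun t => t ^ q - q * (q - 1) / 2 * M ^ (q - 2) * t ^ 2) (Set.Icc 0 M) := by
  refine monotoneOn_of_deriv_nonneg (convex_Icc 0 M)
    ((Real.continuous_rpow_const (zero_le_one.trans hq)).sub (by fun_prop)).continuousOn ?_ ?_
  all_goals
    rw [interior_Icc]
    rintro t ⟨ht0, htM⟩
  · exact (hasDerivAt_rpow_sub_mul_sq ht0.ne').differentiableAt.differentiableWithinAt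
  · have hpow : M ^ (q - 2) ≤ t ^ (q - 2) :=
      Real.rpow_le_rpow_of_nonpos ht0 htM.le (by linarith)
    have hfactor : (q - 1) * M ^ (q - 2) ≤ t ^ (q - 2) :=
      (mul_le_of_le_one_left (Real.rpow_nonneg (ht0.trans htM).le _) (by linarith)).trans hpow
    rw [(hasDerivAt_rpow_sub_mul_sq ht0.ne').deriv, show q - 1 = q - 2 + 1 by ring,
      Real.rpow_add_one ht0.ne']
    linarith [mul_le_mul_of_nonneg_left hfactor (mul_nonneg (zero_le_one.trans hq) ht0.le)]

theorem strongConvexOn_norm_rpow {E : Type*} [NormedAddCommGroup E] [InnerProductSpace ℝ E]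
    {q : ℝ} (hq : 1 ≤ q) (hq2 : q ≤ 2) (M : ℝ) :
    StrongConvexOn (Metric.closedBall (0 : E) M) (q * (q - 1) * M ^ (q - 2))
      fun x => ‖x‖ ^ q := by
  have hball := convex_closedBall (0 : E) M
  have himage : norm '' Metric.closedBall (0 : E) M ⊆ Set.Icc 0 M := by
    rintro _ ⟨x, hx, rfl⟩
    exact ⟨norm_nonneg x, mem_closedBall_zero_iff.1 hx⟩
  have hconvex : Convex ℝ (norm '' Metric.closedBall (0 : E) M) :=
    (hball.isPreconnected.image _ continuous_norm.continuousOn).ordConnected.convex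
  rw [strongConvexOn_iff_convex, ← div_mul_eq_mul_div]
  exact ((convexOn_rpow_sub_mul_sq hq hq2 M).subset himage hconvex).comp
    (convexOn_norm hball) ((monotoneOn_rpow_sub_mul_sq hq hq2 M).mono himage)

theorem norm_le_rpow_of_tsum_norm_rpow_le {ι E : Type*} [SeminormedAddCommGroup E] {q B : ℝ}
    (hq : 0 < q) {x : ι → E} (hx : Summable fun i => ‖x i‖ ^ q) (hB : ∑' i, ‖x i‖ ^ q ≤ B)
    (i : ι) : ‖x i‖ ≤ B ^ (1 / q) := by
  have hterm : ‖x i‖ ^ q ≤ B := (hx.le_tsum i fun _ _ => by positivity).trans hB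
  rw [one_div]
  exact (Real.le_rpow_inv_iff_of_pos (norm_nonneg _)
    ((Real.rpow_nonneg (norm_nonneg _) q).trans hterm) hq).2 hterm

/-- The constant with which the Bregman distance of `∑ |x i| ^ q` dominates `∑ (x i - y i) ^ 2` for
sequences with `∑ |x i| ^ q ≤ B`: half the smallest second derivative of `|t| ^ q` for
`|t| ≤ B ^ (1 / q)`. -/
noncomputable def bregmanModulus (q B : ℝ) : ℝ :=
  q * (q - 1) / 2 * (B ^ (1 / q)) ^ (q - 2)

theorem bregmanModulus_pos {q B : ℝ} (hq : 1 < q) (hB : 0 < B) : 0 < bregmanModulus q B := by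
  have : 0 < q - 1 := sub_pos.2 hq
  unfold bregmanModulus
  positivity

theorem summable_sq_sub_and_bregmanModulus_mul_tsum_le {ι : Type*} {q B : ℝ} (hq : 1 < q)
    (hq2 : q ≤ 2) (hB : 0 < B) {x y : ι → ℝ} (hx : Summable fun i => |x i| ^ q)
    (hy : Summable fun i => |y i| ^ q) (hxB : ∑' i, |x i| ^ q ≤ B) (hyB : ∑' i, |y i| ^ q ≤ B)
    (hgrad : Summable fun i => q * |x i| ^ (q - 2) * x i * (y i - x i)) :
    (Summable fun i => (y i - x i) ^ 2) ∧
      bregmanModulus q B * ∑' i, (y i - x i) ^ 2 ≤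
        ∑' i, |y i| ^ q - ∑' i, |x i| ^ q - ∑' i, q * |x i| ^ (q - 2) * x i * (y i - x i) := by
  have hq0 : 0 < q := zero_lt_one.trans hq
  have hpos : 0 < bregmanModulus q B := bregmanModulus_pos hq hB
  have hconvex : UniformConvexOn (Metric.closedBall 0 (B ^ (1 / q)))
      (fun r => bregmanModulus q B * r ^ 2) fun t : ℝ => ‖t‖ ^ q := by
    have hstrong := strongConvexOn_norm_rpow (E := ℝ) hq.le hq2 (B ^ (1 / q))
    rwa [StrongConvexOn, mul_div_right_comm] at hstrong
  have hderiv i : HasLineDerivAt ℝ (fun t : ℝ => ‖t‖ ^ q)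
      (q * |x i| ^ (q - 2) * x i * (y i - x i)) (x i) (y i - x i) := by
    simpa [mul_comm] using (hasDerivAt_norm_rpow (x i) hq).hasFDerivAt.hasLineDerivAt (y i - x i)
  have hmem {z : ι → ℝ} (hz : Summable fun i => |z i| ^ q) (hzB : ∑' i, |z i| ^ q ≤ B) (i : ι) :
      z i ∈ Metric.closedBall 0 (B ^ (1 / q)) :=
    mem_closedBall_zero_iff.2 (norm_le_rpow_of_tsum_norm_rpow_le (x := z) hq0 hz hzB i)
  have hnonneg (r : ℝ) : 0 ≤ bregmanModulus q B * r ^ 2 := by positivity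
  obtain ⟨hsum, hle⟩ := summable_modulus_and_tsum_modulus_le hconvex hnonneg (hmem hx hxB)
    (hmem hy hyB) hderiv hx hy hgrad
  simp only [Real.norm_eq_abs, sq_abs, tsum_mul_left] at hsum hle
  exact ⟨(summable_mul_left_iff hpos.ne').1 hsum, hle⟩

theorem sub_sub_inner_le_of_tikhonov_le {H : Type*} [NormedAddCommGroup H]
    [InnerProductSpace ℝ H] {f v vδ w : H} {R R₀ α δ : ℝ} (hα : 0 < α) (hv : ‖v - vδ‖ ≤ δ)
    (h : ‖f - vδ‖ ^ 2 + α * R ≤ ‖v - vδ‖ ^ 2 + α * R₀) :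
    R - R₀ - inner ℝ w (f - v) ≤ δ ^ 2 / α + ‖w‖ * δ + α * ‖w‖ ^ 2 / 4 := by
  have htriangle : ‖f - v‖ ≤ ‖f - vδ‖ + δ := by
    linarith [norm_sub_le_norm_sub_add_norm_sub f vδ v, norm_sub_rev vδ v]
  have hinner : -inner ℝ w (f - v) ≤ ‖w‖ * (‖f - vδ‖ + δ) :=
    ((neg_le_abs _).trans (abs_real_inner_le_norm w (f - v))).trans
      (mul_le_mul_of_nonneg_left htriangle (norm_nonneg _))
  have hnoise : ‖v - vδ‖ ^ 2 ≤ δ ^ 2 := pow_le_pow_left₀ (norm_nonneg _) hv 2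
  have hyoung : α * (‖w‖ * ‖f - vδ‖) ≤ ‖f - vδ‖ ^ 2 + α ^ 2 * ‖w‖ ^ 2 / 4 := by
    linarith [sq_nonneg (‖f - vδ‖ - α * ‖w‖ / 2)]
  refine le_of_mul_le_mul_left ?_ hα
  calc α * (R - R₀ - inner ℝ w (f - v))
      = α * R - α * R₀ + α * -inner ℝ w (f - v) := by ring
    _ ≤ (δ ^ 2 - ‖f - vδ‖ ^ 2) + α * (‖w‖ * (‖f - vδ‖ + δ)) := by
      linarith [mul_le_mul_of_nonneg_left hinner hα.le]
    _ ≤ δ ^ 2 + α * (‖w‖ * δ) + α ^ 2 * ‖w‖ ^ 2 / 4 := by linarith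
    _ = α * (δ ^ 2 / α + ‖w‖ * δ + α * ‖w‖ ^ 2 / 4) := by field_simp

/-! ### Weighted coefficient sequences -/

theorem summable_norm_rpow_of_le {ι E : Type*} [NormedAddCommGroup E] {x : ι → E} {p q : ℝ}
    (hp : 0 < p) (hpq : p ≤ q) (hx : Summable fun i => ‖x i‖ ^ p) :
    Summable fun i => ‖x i‖ ^ q := by
  have hq : 0 < q := hp.trans_le hpq
  have hmem : Memℓp x (ENNReal.ofReal p) :=
    memℓp_gen (by rwa [ENNReal.toReal_ofReal hp.le])
  have hsum := (hmem.of_exponent_ge (ENNReal.ofReal_le_ofReal hpq)).summable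
    (by rwa [ENNReal.toReal_ofReal hq.le])
  rwa [ENNReal.toReal_ofReal hq.le] at hsum

section Coefficients

variable {d : ℕ}

/-- The exponent `τ` for which the `B^s_p`-norm is the `ℓ_p`-norm of the sequence
`2^{τ|λ|} u_λ`. -/
noncomputable def weightExponent (d : ℕ) (s p : ℝ) : ℝ := s + d * (1 / 2 - 1 / p)

theorem weightExponent_two (s : ℝ) : weightExponent d s 2 = s := by
  simp [weightExponent]

/-- The weighted coefficient sequence `2^{τ|λ|} c_λ`. -/
noncomputable def rescale (τ : ℝ) (c : Index d → ℝ) (l : Index d) : ℝ :=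
  2 ^ (τ * l.level) * c l

theorem rescale_sub (τ : ℝ) (a b : Index d → ℝ) (l : Index d) :
    rescale τ (a - b) l = rescale τ a l - rescale τ b l :=
  mul_sub _ _ _

theorem abs_rescale_rpow (p τ : ℝ) (c : Index d → ℝ) (l : Index d) :
    |rescale τ c l| ^ p = 2 ^ (p * τ * l.level) * |c l| ^ p := by
  rw [rescale, abs_mul, Real.mul_rpow (abs_nonneg _) (abs_nonneg _), abs_of_pos (by positivity),
    ← Real.rpow_mul zero_le_two]
  ring_nf

theorem seqNorm_mono {s p : ℝ} (hp : 0 ≤ p) {a b : Index d → ℝ} (h : ∀ l, |a l| ≤ |b l|) :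
    seqNorm s p a ≤ seqNorm s p b := by
  unfold seqNorm
  gcongr (∑' l, ENNReal.ofReal (_ * ?_ ^ _)) ^ _ with l
  exact h l

theorem seqNorm_rpow {s p : ℝ} (hp : p ≠ 0) (c : Index d → ℝ) :
    seqNorm s p c ^ p = ∑' l, ENNReal.ofReal (|rescale (weightExponent d s p) c l| ^ p) := by
  simp only [seqNorm, abs_rescale_rpow, weightExponent]
  rw [← ENNReal.rpow_mul, one_div_mul_cancel hp, ENNReal.rpow_one]

theorem seqNorm_lt_top_iff_summable {s p : ℝ} (hp : 0 < p) (c : Index d → ℝ) :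
    seqNorm s p c < ⊤ ↔ Summable fun l => |rescale (weightExponent d s p) c l| ^ p := by
  rw [← ENNReal.rpow_lt_top_iff_of_pos hp, seqNorm_rpow hp.ne']
  refine ⟨fun h => ?_, Summable.tsum_ofReal_lt_top⟩
  exact (ENNReal.summable_toReal h.ne).congr fun l => ENNReal.toReal_ofReal (by positivity)

theorem seqNorm_rpow_eq_ofReal {s p : ℝ} (hp : p ≠ 0) {c : Index d → ℝ}
    (hc : Summable fun l => |rescale (weightExponent d s p) c l| ^ p) :
    seqNorm s p c ^ p = ENNReal.ofReal (∑' l, |rescale (weightExponent d s p) c l| ^ p) := by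
  rw [seqNorm_rpow hp, ENNReal.ofReal_tsum_of_nonneg (fun _ => by positivity) hc]

/-! ### The derivative of the penalty -/

/-- The derivative of `∑ |2^{τ|λ|} c_λ| ^ q` with respect to the coefficients `c_λ`. -/
noncomputable def penaltyGradient (τ q : ℝ) (c : Index d → ℝ) (l : Index d) : ℝ :=
  q * 2 ^ (τ * l.level) * |rescale τ c l| ^ (q - 2) * rescale τ c l

theorem penaltyGradient_mul (τ q : ℝ) (c z : Index d → ℝ) (l : Index d) :
    penaltyGradient τ q c l * z l =
      q * |rescale τ c l| ^ (q - 2) * rescale τ c l * rescale τ z l := by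
  simp only [penaltyGradient, rescale]
  ring

theorem abs_rpow_sub_two_mul_abs {q : ℝ} (hq : q ≠ 1) (x : ℝ) :
    |x| ^ (q - 2) * |x| = |x| ^ (q - 1) := by
  rw [← Real.rpow_add_one' (abs_nonneg x) fun h => hq (by linarith)]
  ring_nf

theorem abs_rpow_sub_two_mul_sq {q : ℝ} (hq : q ≠ 0) (x : ℝ) :
    |x| ^ (q - 2) * x ^ 2 = |x| ^ q := by
  rw [← sq_abs, ← Real.rpow_two, ← Real.rpow_add' (abs_nonneg x) (by simpa using hq),
    sub_add_cancel]

theorem abs_penaltyGradient {q : ℝ} (hq : 1 < q) (τ : ℝ) (c : Index d → ℝ) (l : Index d) :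
    |penaltyGradient τ q c l| = q * 2 ^ (τ * l.level) * |rescale τ c l| ^ (q - 1) := by
  have hnonneg : 0 ≤ q * (2 : ℝ) ^ (τ * l.level) * |rescale τ c l| ^ (q - 2) := by positivity
  rw [penaltyGradient, abs_mul, abs_of_nonneg hnonneg, mul_assoc,
    abs_rpow_sub_two_mul_abs hq.ne']

theorem abs_rescale_penaltyGradient_le {q τ τG τS : ℝ} (hq : 1 < q)
    (h : τG + q * τ ≤ (q - 1) * τS) (c : Index d → ℝ) (l : Index d) :
    |rescale τG (penaltyGradient τ q c) l| ≤ q * |rescale τS c l| ^ (q - 1) := by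
  have hweight : (2 : ℝ) ^ ((τG + q * τ) * l.level) ≤ 2 ^ ((q - 1) * τS * l.level) := by
    gcongr
    exact one_le_two
  have hsplit : (2 : ℝ) ^ ((τG + q * τ) * l.level) =
      2 ^ (τG * l.level) * 2 ^ (τ * l.level) * 2 ^ ((q - 1) * τ * l.level) := by
    rw [← Real.rpow_add two_pos, ← Real.rpow_add two_pos]
    ring_nf
  calc |rescale τG (penaltyGradient τ q c) l|
      = 2 ^ (τG * l.level) * (q * 2 ^ (τ * l.level) * |rescale τ c l| ^ (q - 1)) := by
        rw [rescale, abs_mul, abs_of_pos (by positivity), abs_penaltyGradient hq]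
    _ = q * (2 ^ ((τG + q * τ) * l.level) * |c l| ^ (q - 1)) := by
        rw [abs_rescale_rpow, hsplit]
        ring
    _ ≤ q * |rescale τS c l| ^ (q - 1) := by
        rw [abs_rescale_rpow]
        gcongr

theorem seqNorm_penaltyGradient_lt_top {sS pS sG pG τ q : ℝ} (hpS : 0 < pS) (hpG : 0 < pG)
    (hq : 1 < q) (hp : pS ≤ (q - 1) * pG)
    (hτ : weightExponent d sG pG + q * τ ≤ (q - 1) * weightExponent d sS pS)
    {c : Index d → ℝ} (hc : seqNorm sS pS c < ⊤) :
    seqNorm sG pG (penaltyGradient τ q c) < ⊤ := by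
  rw [seqNorm_lt_top_iff_summable hpS] at hc
  rw [seqNorm_lt_top_iff_summable hpG]
  have hsum := (summable_norm_rpow_of_le (x := rescale (weightExponent d sS pS) c) hpS hp
    hc).mul_left (q ^ pG)
  refine hsum.of_nonneg_of_le (fun _ => by positivity) fun l => ?_
  calc |rescale (weightExponent d sG pG) (penaltyGradient τ q c) l| ^ pG
      ≤ (q * |rescale (weightExponent d sS pS) c l| ^ (q - 1)) ^ pG := by
        gcongr
        exact abs_rescale_penaltyGradient_le hq hτ c l
    _ = q ^ pG * |rescale (weightExponent d sS pS) c l| ^ ((q - 1) * pG) := by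
        rw [Real.mul_rpow (by positivity) (by positivity), ← Real.rpow_mul (abs_nonneg _)]

theorem weightExponent_add_mul_weightExponent_le {sS pS sG pG sR p : ℝ} (hpS : pS ≠ 0)
    (hpG : 0 < pG) (hp : 0 < p)
    (hsR : sR ≤ (p * sS - pG * sG) / (p + pG) - d * (1 / (p + pG) * (p / pS - 1))) :
    weightExponent d sG pG + (p + pG) / pG * weightExponent d sR ((p + pG) / pG) ≤
      p / pG * weightExponent d sS pS := by
  have hpos : 0 < p + pG := add_pos hp hpG
  have hsR' : (p + pG) * sR ≤ p * sS - pG * sG - d * (p / pS - 1) := by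
    refine (mul_le_mul_of_nonneg_left hsR hpos.le).trans_eq ?_
    field_simp
  refine le_of_mul_le_mul_left ?_ hpG
  calc pG * (weightExponent d sG pG + (p + pG) / pG * weightExponent d sR ((p + pG) / pG))
      = (p + pG) * sR + pG * sG + d * (p / 2 - 1) := by
        unfold weightExponent
        field_simp
        ring
    _ ≤ p * sS - d * (p / pS - 1) + d * (p / 2 - 1) := by linarith
    _ = pG * (p / pG * weightExponent d sS pS) := by
        unfold weightExponent
        field_simp
        ring

end Coefficients

namespace WaveletBasis

variable {d : ℕ} {W : WaveletBasis d}

/-! ### Duality of coefficient sequences -/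

theorem coeff_sub (u v : Tempered d) : W.coeff (u - v) = W.coeff u - W.coeff v := rfl

theorem coeff_sum_smul_psi (S : Finset (Index d)) (a : Index d → ℝ) (m : Index d) :
    W.coeff (∑ l ∈ S, a l • ofSchwartz (W.psi l)) m = if m ∈ S then a m else 0 := by
  have hsum : W.coeff (∑ l ∈ S, a l • ofSchwartz (W.psi l)) m =
      ∑ l ∈ S, a l * W.coeff (ofSchwartz (W.psi l)) m := by
    simp [coeff]
  simp [hsum, coeff_ofSchwartz_psi]

theorem besovNorm_sum_smul_psi_le {s p : ℝ} (hp : 0 ≤ p) (S : Finset (Index d))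
    {a b : Index d → ℝ} (h : ∀ l ∈ S, |a l| ≤ |b l|) :
    W.besovNorm s p (∑ l ∈ S, a l • ofSchwartz (W.psi l)) ≤ seqNorm s p b := by
  refine seqNorm_mono hp fun l => ?_
  rw [coeff_sum_smul_psi]
  split_ifs with hl
  · exact h l hl
  · simp

theorem EmbedsInDual.exists_tsum_enorm_le {s₁ p₁ s p : ℝ} {hp₁ : 0 < p₁} {hp : 0 < p}
    (h : W.EmbedsInDual s₁ p₁ hp₁ s p hp) :
    ∃ C : ℝ≥0, ∀ (a : Index d → ℝ) (u : Tempered d),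
      ∑' l, ‖a l * W.coeff u l‖ₑ ≤ C * seqNorm s₁ p₁ a * W.besovNorm s p u := by
  obtain ⟨C, hC⟩ := h
  refine ⟨C, fun a u => ?_⟩
  rw [ENNReal.tsum_eq_iSup_sum]
  refine iSup_le fun S => ?_
  -- Changing the signs of the coefficients of `u` turns its pairing with `∑ a_λ ψ_λ` into
  -- `∑ |a_λ u_λ|`.
  let e (l : Index d) : ℝ := SignType.sign (a l * W.coeff u l) * W.coeff u l
  have he l : |e l| ≤ |W.coeff u l| := by
    rw [abs_mul]
    refine mul_le_of_le_one_left (abs_nonneg _) ?_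
    rcases SignType.sign (a l * W.coeff u l) with _ | _ | _ <;> simp
  obtain ⟨ξ, hξ, hbound⟩ := hC (∑ l ∈ S, a l • ofSchwartz (W.psi l))
    (Submodule.sum_mem _ fun l _ => Submodule.smul_mem _ _ (W.psi_mem_besov s₁ p₁ hp₁ l))
  have hξe : ξ (∑ l ∈ S, e l • W.basisElt s p hp l) = ∑ l ∈ S, |a l * W.coeff u l| := by
    rw [map_sum]
    refine Finset.sum_congr rfl fun l hl => ?_
    rw [map_smul, hξ, coeff_sum_smul_psi, if_pos hl, smul_eq_mul, ← sign_mul_self]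
    ring
  calc ∑ l ∈ S, ‖a l * W.coeff u l‖ₑ
      = ‖ξ (∑ l ∈ S, e l • W.basisElt s p hp l)‖ₑ := by
        rw [hξe, Real.enorm_of_nonneg (by positivity),
          ENNReal.ofReal_sum_of_nonneg fun _ _ => abs_nonneg _]
        simp only [Real.enorm_eq_ofReal_abs]
    _ ≤ C * W.besovNorm s₁ p₁ (∑ l ∈ S, a l • ofSchwartz (W.psi l)) *
          W.besovNorm s p (∑ l ∈ S, e l • W.basisElt s p hp l : W.besov s p hp) := hbound _
    _ ≤ C * seqNorm s₁ p₁ a * W.besovNorm s p u := by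
        gcongr
        · exact besovNorm_sum_smul_psi_le hp₁.le S fun _ _ => le_rfl
        · rw [AddSubmonoidClass.coe_finsetSum]
          exact besovNorm_sum_smul_psi_le hp.le S fun l _ => he l

theorem EmbedsInDual.summable_mul {s₁ p₁ s p : ℝ} {hp₁ : 0 < p₁} {hp : 0 < p}
    (h : W.EmbedsInDual s₁ p₁ hp₁ s p hp) {a : Index d → ℝ} (ha : seqNorm s₁ p₁ a < ⊤)
    (u : W.besov s p hp) : Summable fun l => a l * W.coeff u l := by
  obtain ⟨C, hC⟩ := h.exists_tsum_enorm_le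
  exact Summable.of_enorm ((hC a u).trans_lt
    (ENNReal.mul_lt_top (ENNReal.mul_lt_top ENNReal.coe_lt_top ha) u.2)).ne

theorem EmbedsInDual.exists_mem_besovInDual {s₁ p₁ s p : ℝ} {hp₁ : 0 < p₁} {hp : 0 < p}
    (h : W.EmbedsInDual s₁ p₁ hp₁ s p hp) {a : Index d → ℝ} (ha : seqNorm s₁ p₁ a < ⊤) :
    ∃ ξ ∈ W.besovInDual s₁ p₁ s p hp,
      ∀ u : W.besov s p hp, HasSum (fun l => a l * W.coeff u l) (ξ u) := by
  have hsum (u : W.besov s p hp) := h.summable_mul ha u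
  obtain ⟨C, hC⟩ := h.exists_tsum_enorm_le
  let ξ : W.besov s p hp →ₗ[ℝ] ℝ :=
    { toFun := fun u => ∑' l, a l * W.coeff u l
      map_add' := fun u u' => by
        rw [← (hsum u).tsum_add (hsum u')]
        exact tsum_congr fun l => mul_add _ _ _
      map_smul' := fun r u => by
        rw [RingHom.id_apply, smul_eq_mul, ← tsum_mul_left]
        exact tsum_congr fun l => mul_left_comm _ _ _ }
  have hcoeff : (fun l => ξ (W.basisElt s p hp l)) = a := by
    funext l
    change ∑' m, a m * W.coeff (ofSchwartz (W.psi l)) m = a l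
    simp [coeff_ofSchwartz_psi]
  refine ⟨ξ, ⟨⟨C * (seqNorm s₁ p₁ a).toNNReal, fun u => ?_⟩, by rwa [hcoeff]⟩,
    fun u => (hsum u).hasSum⟩
  rw [ENNReal.coe_mul, ENNReal.coe_toNNReal ha.ne]
  exact enorm_tsum_le_tsum_enorm.trans (hC a u)

/-! ### Convergence rates under a source condition -/

section Tikhonov

variable {s p : ℝ} {hp : 0 < p} {F : W.besov s p hp →ₗ[ℝ] L2 d}

/-- The source condition at `u₀`: the derivative at `u₀` of the penalty `∑ |2^{τ|λ|} u_λ| ^ q` is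
the functional `F^* w`, in the sense that it is given by a convergent series of coefficients. -/
def SourceCondition (F : W.besov s p hp →ₗ[ℝ] L2 d) (τ q : ℝ) (u₀ : W.besov s p hp)
    (w : L2 d) : Prop :=
  ∀ u : W.besov s p hp,
    HasSum (fun l => penaltyGradient τ q (W.coeff u₀) l * W.coeff u l) (W.adjoint F w u)

theorem exists_sourceCondition {s₁ p₁ τ q : ℝ} {hp₁ : 0 < p₁}
    (hdual : W.EmbedsInDual s₁ p₁ hp₁ s p hp)
    (hrange : W.besovInDual s₁ p₁ s p hp ⊆ Set.range (W.adjoint F)) {u₀ : W.besov s p hp}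
    (hgrad : seqNorm s₁ p₁ (penaltyGradient τ q (W.coeff u₀)) < ⊤) :
    ∃ w, SourceCondition F τ q u₀ w := by
  obtain ⟨ξ, hξ, hsum⟩ := hdual.exists_mem_besovInDual hgrad
  obtain ⟨w, rfl⟩ := hrange hξ
  exact ⟨w, hsum⟩

namespace SourceCondition

variable {τ q : ℝ} {u₀ : W.besov s p hp} {w : L2 d}

theorem summable_rpow (h : SourceCondition F τ q u₀ w) (hq : q ≠ 0) :
    Summable fun l => |rescale τ (W.coeff u₀) l| ^ q := by
  refine (summable_mul_left_iff hq).1 ((h u₀).summable.congr fun l => ?_)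
  rw [penaltyGradient_mul, ← abs_rpow_sub_two_mul_sq hq]
  ring

theorem hasSum_mul_sub (h : SourceCondition F τ q u₀ w) (u : W.besov s p hp) :
    HasSum (fun l => q * |rescale τ (W.coeff u₀) l| ^ (q - 2) * rescale τ (W.coeff u₀) l *
      (rescale τ (W.coeff u) l - rescale τ (W.coeff u₀) l)) (inner ℝ w (F u - F u₀)) := by
  have hsum := h (u - u₀)
  rw [adjoint_apply, LinearMap.map_sub F u u₀] at hsum
  simpa only [penaltyGradient_mul, Submodule.coe_sub, coeff_sub, rescale_sub] using hsum

end SourceCondition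

theorem besovNorm_lt_top_of_tikhonov_lt_top {sR pR α : ℝ} {vδ : L2 d} {u : W.besov s p hp}
    (hpR : 0 < pR) (hα : 0 < α) (h : W.tikhonov F sR pR vδ α u < ⊤) :
    W.besovNorm sR pR u < ⊤ := by
  have hpenalty := (ENNReal.add_lt_top.1 h).2
  rw [← ENNReal.rpow_lt_top_iff_of_pos hpR]
  exact ENNReal.lt_top_of_mul_ne_top_right hpenalty.ne (ENNReal.ofReal_pos.2 hα).ne'

theorem tikhonov_eq_ofReal {sR pR α : ℝ} {vδ : L2 d} {u : W.besov s p hp} (hpR : pR ≠ 0)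
    (hα : 0 ≤ α)
    (hu : Summable fun l => |rescale (weightExponent d sR pR) (W.coeff u) l| ^ pR) :
    W.tikhonov F sR pR vδ α u = ENNReal.ofReal (‖F u - vδ‖ ^ 2 +
      α * ∑' l, |rescale (weightExponent d sR pR) (W.coeff u) l| ^ pR) := by
  rw [tikhonov, besovNorm, seqNorm_rpow_eq_ofReal hpR hu, ← ofReal_norm,
    ← ENNReal.ofReal_pow (norm_nonneg _), ← ENNReal.ofReal_mul hα,
    ← ENNReal.ofReal_add (by positivity) (by positivity)]

theorem summable_and_le_of_tikhonov_le {sR pR α : ℝ} {vδ : L2 d} {u u₀ : W.besov s p hp}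
    (hpR : 0 < pR) (hα : 0 < α)
    (hu₀ : Summable fun l => |rescale (weightExponent d sR pR) (W.coeff u₀) l| ^ pR)
    (h : W.tikhonov F sR pR vδ α u ≤ W.tikhonov F sR pR vδ α u₀) :
    (Summable fun l => |rescale (weightExponent d sR pR) (W.coeff u) l| ^ pR) ∧
      ‖F u - vδ‖ ^ 2 + α * ∑' l, |rescale (weightExponent d sR pR) (W.coeff u) l| ^ pR ≤
        ‖F u₀ - vδ‖ ^ 2 +
          α * ∑' l, |rescale (weightExponent d sR pR) (W.coeff u₀) l| ^ pR := by
  rw [tikhonov_eq_ofReal hpR.ne' hα.le hu₀] at h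
  have hu := (seqNorm_lt_top_iff_summable hpR _).1
    (besovNorm_lt_top_of_tikhonov_lt_top hpR hα (h.trans_lt ENNReal.ofReal_lt_top))
  rw [tikhonov_eq_ofReal hpR.ne' hα.le hu] at h
  exact ⟨hu, (ENNReal.ofReal_le_ofReal_iff (by positivity)).1 h⟩

theorem sobolevNorm_eq_ofReal {σ : ℝ} {u : Tempered d}
    (hu : Summable fun l => rescale σ (W.coeff u) l ^ 2) :
    W.sobolevNorm σ u = ENNReal.ofReal √(∑' l, rescale σ (W.coeff u) l ^ 2) := by
  have hrpow l : |rescale (weightExponent d σ 2) (W.coeff u) l| ^ (2 : ℝ) =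
      rescale σ (W.coeff u) l ^ 2 := by
    rw [weightExponent_two, Real.rpow_two, sq_abs]
  have hsq : W.sobolevNorm σ u ^ (2 : ℝ) =
      ENNReal.ofReal (∑' l, rescale σ (W.coeff u) l ^ 2) := by
    rw [sobolevNorm, besovNorm, seqNorm_rpow_eq_ofReal two_ne_zero
      (hu.congr fun l => (hrpow l).symm), tsum_congr hrpow]
  rw [Real.sqrt_eq_rpow, ← ENNReal.ofReal_rpow_of_nonneg (by positivity) (by positivity), ← hsq,
    ← ENNReal.rpow_mul, mul_one_div_cancel two_ne_zero, ENNReal.rpow_one]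

theorem SourceCondition.bregmanModulus_mul_tsum_sq_sub_le {sR pR α δ B : ℝ}
    {u u₀ : W.besov s p hp} {w vδ : L2 d} (hpR : 1 < pR) (hpR2 : pR ≤ 2)
    (hsource : SourceCondition F (weightExponent d sR pR) pR u₀ w) (hα : 0 < α)
    (hδ : ‖F u₀ - vδ‖ ≤ δ) (hB : 0 < B)
    (hB_le : ∑' l, |rescale (weightExponent d sR pR) (W.coeff u₀) l| ^ pR + δ ^ 2 / α ≤ B)
    (hle : W.tikhonov F sR pR vδ α u ≤ W.tikhonov F sR pR vδ α u₀) :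
    (Summable fun l => rescale (weightExponent d sR pR) (W.coeff (u - u₀)) l ^ 2) ∧
      bregmanModulus pR B *
          ∑' l, rescale (weightExponent d sR pR) (W.coeff (u - u₀)) l ^ 2 ≤
        δ ^ 2 / α + ‖w‖ * δ + α * ‖w‖ ^ 2 / 4 := by
  have hpR0 : 0 < pR := zero_lt_one.trans hpR
  have hu₀ := hsource.summable_rpow hpR0.ne'
  obtain ⟨hu, hmin⟩ := summable_and_le_of_tikhonov_le hpR0 hα hu₀ hle
  have hnoise : ‖F u₀ - vδ‖ ^ 2 ≤ δ ^ 2 := by gcongr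
  have hδα : 0 ≤ δ ^ 2 / α := by positivity
  have hbounded : ∑' l, |rescale (weightExponent d sR pR) (W.coeff u) l| ^ pR ≤ B := by
    refine (le_of_mul_le_mul_left ?_ hα).trans hB_le
    rw [mul_add, mul_div_cancel₀ _ hα.ne']
    linarith [sq_nonneg ‖F u - vδ‖]
  have hgrad := hsource.hasSum_mul_sub u
  obtain ⟨hsum, hbreg⟩ := summable_sq_sub_and_bregmanModulus_mul_tsum_le hpR hpR2 hB hu₀ hu
    (by linarith) hbounded hgrad.summable
  rw [hgrad.tsum_eq] at hbreg
  simp only [coeff_sub, rescale_sub]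
  exact ⟨hsum, hbreg.trans (sub_sub_inner_le_of_tikhonov_le hα hδ hmin)⟩

theorem SourceCondition.exists_sobolevNorm_le {sR pR c₁ c₂ δ₀ : ℝ} {u₀ : W.besov s p hp}
    {w : L2 d} (hpR : 1 < pR) (hpR2 : pR ≤ 2)
    (hsource : SourceCondition F (weightExponent d sR pR) pR u₀ w) (hc₁ : 0 < c₁) (hc₂ : 0 < c₂)
    (hδ₀ : 0 < δ₀) :
    ∃ K > 0, ∀ δ : ℝ, 0 < δ → δ ≤ δ₀ → ∀ α : ℝ, c₁ * δ ≤ α → α ≤ c₂ * δ →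
      ∀ vδ : L2 d, ‖F u₀ - vδ‖ ≤ δ → ∀ u : W.besov s p hp,
        W.tikhonov F sR pR vδ α u ≤ W.tikhonov F sR pR vδ α u₀ →
          W.sobolevNorm (weightExponent d sR pR) (u - u₀) ≤ ENNReal.ofReal (K * √δ) := by
  set B := ∑' l, |rescale (weightExponent d sR pR) (W.coeff u₀) l| ^ pR + δ₀ / c₁
  have hBpos : 0 < B := by positivity
  have hmodulus : 0 < bregmanModulus pR B := bregmanModulus_pos hpR hBpos
  set E := 1 / c₁ + ‖w‖ + c₂ * ‖w‖ ^ 2 / 4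
  refine ⟨√(E / bregmanModulus pR B), by positivity, fun δ hδ hδ_le α hα₁ hα₂ vδ hvδ u hle => ?_⟩
  have hα : 0 < α := lt_of_lt_of_le (by positivity) hα₁
  have hδα : δ ^ 2 / α ≤ δ / c₁ := by
    rw [div_le_div_iff₀ hα hc₁, sq, mul_assoc]
    exact mul_le_mul_of_nonneg_left (by linarith) hδ.le
  have hδα₀ : δ ^ 2 / α ≤ δ₀ / c₁ := hδα.trans (by gcongr)
  obtain ⟨hsum, hbound⟩ := hsource.bregmanModulus_mul_tsum_sq_sub_le hpR hpR2 hα hvδ hBpos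
    (by linarith) hle
  rw [sobolevNorm_eq_ofReal hsum, ← Real.sqrt_mul (by positivity)]
  gcongr
  rw [div_mul_eq_mul_div, le_div_iff₀' hmodulus]
  calc bregmanModulus pR B * ∑' l, rescale (weightExponent d sR pR) (W.coeff (u - u₀)) l ^ 2
      ≤ δ ^ 2 / α + ‖w‖ * δ + α * ‖w‖ ^ 2 / 4 := hbound
    _ ≤ δ / c₁ + ‖w‖ * δ + c₂ * δ * ‖w‖ ^ 2 / 4 := by gcongr
    _ = E * δ := by ring

end Tikhonov

end WaveletBasis

end BesovTikhonov

open BesovTikhonov in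
theorem mainTheorem4_general
    {d : ℕ} (W : WaveletBasis d) {sD pD sS pS sG pG : ℝ} (hpD : 0 < pD) (hpS : 0 < pS)
    (hpG : 0 < pG) (F : W.besov sD pD hpD →ₗ[ℝ] L2 d)
    (hGD : W.EmbedsInDual sG pG hpG sD pD hpD)
    (hG : W.besovInDual sG pG sD pD hpD ⊆ Set.range (W.adjoint F))
    (uTrue : W.besov sD pD hpD) (huS : (uTrue : Tempered d) ∈ W.besov sS pS hpS)
    {p : ℝ} (hSp : pS ≤ p) (hpG_le : p ≤ pG) {sR pR : ℝ} (hpR : pR = (p + pG) / pG)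
    (hsR : sR ≤ (p * sS - pG * sG) / (p + pG) - d * (1 / (p + pG) * (p / pS - 1)))
    {c₁ c₂ δ₀ : ℝ} (hc₁ : 0 < c₁) (hc₂ : 0 < c₂) (hδ₀ : 0 < δ₀) :
    ∃ K > 0, ∀ δ : ℝ, 0 < δ → δ ≤ δ₀ → ∀ α : ℝ, c₁ * δ ≤ α → α ≤ c₂ * δ →
      ∀ vδ : L2 d, ‖F uTrue - vδ‖ ≤ δ → ∀ u : W.besov sD pD hpD,
        W.tikhonov F sR pR vδ α u ≤ W.tikhonov F sR pR vδ α uTrue →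
          W.sobolevNorm (sR + d * (1 / 2 - 1 / pR)) ((u : Tempered d) - uTrue) ≤
            ENNReal.ofReal (K * √δ) := by
  have hp : 0 < p := hpS.trans_le hSp
  have hpR_sub_one : pR - 1 = p / pG := by rw [hpR, add_div, div_self hpG.ne', add_sub_cancel_right]
  have hpR_gt : 1 < pR := sub_pos.1 (hpR_sub_one ▸ div_pos hp hpG)
  have hpR_le : pR ≤ 2 := by linarith [(div_le_one hpG).2 hpG_le]
  have hgrad : seqNorm sG pG (penaltyGradient (weightExponent d sR pR) pR (W.coeff uTrue)) < ⊤ := by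
    refine seqNorm_penaltyGradient_lt_top hpS hpG hpR_gt ?_ ?_ huS
    · rwa [hpR_sub_one, div_mul_cancel₀ p hpG.ne']
    · rw [hpR_sub_one, hpR]
      exact weightExponent_add_mul_weightExponent_le hpS.ne' hpG hp hsR
  obtain ⟨w, hw⟩ := WaveletBasis.exists_sourceCondition hGD hG hgrad
  exact hw.exists_sobolevNorm_le hpR_gt hpR_le hc₁ hc₂ hδ₀

open BesovTikhonov in
theorem mainTheorem4
    {d : ℕ} (hd : 0 < d) (W : WaveletBasis d)
    {sD pD sS pS sG pG : ℝ} (hpD : 1 < pD) (hpS : 0 < pS) (hpG : 0 < pG)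
    (F : W.besov sD pD (zero_lt_one.trans hpD) →ₗ[ℝ] L2 d) (hF : W.IsBoundedOp F)
    (hGD : W.EmbedsInDual sG pG hpG sD pD (zero_lt_one.trans hpD))
    (hG : W.besovInDual sG pG sD pD (zero_lt_one.trans hpD) ⊆ Set.range (W.adjoint F))
    (hSD : W.besov sS pS hpS ≤ W.besov sD pD (zero_lt_one.trans hpD))
    (hSG : pS ≤ pG)
    (uTrue : Tempered d) (huS : uTrue ∈ W.besov sS pS hpS)
    (v : L2 d) (hv : F ⟨uTrue, hSD huS⟩ = v)
    {p : ℝ} (hp : 0 < p) (hSp : pS ≤ p) (hpDG : p ≤ min pD pG)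
    {ε : ℝ} (hε : 0 < ε)
    {sR pR σ : ℝ} (hpR : pR = (p + pG) / pG)
    (hsR : sR ≤ (p * sS - pG * sG) / (p + pG) - d * (1 / (p + pG) * (p / pS - 1))
      - ε * (p / pS - 1))
    (hσ : σ = sR + d * (1 / 2 - 1 / pR))
    {c₁ c₂ : ℝ} (hc₁ : 0 < c₁) (hc₂ : 0 < c₂) :
    ∃ K > 0, ∃ δ₀ > 0, ∀ δ : ℝ, 0 < δ → δ ≤ δ₀ → ∀ α : ℝ, c₁ * δ ≤ α → α ≤ c₂ * δ →
      ∀ vδ : L2 d, ‖v - vδ‖ ≤ δ →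
        ∀ u : W.besov sD pD (zero_lt_one.trans hpD), W.IsTikhonovMinimizer F sR pR vδ α u →
          W.sobolevNorm σ ((u : Tempered d) - uTrue) ≤ ENNReal.ofReal (K * Real.sqrt δ) := by
  subst hv hσ
  obtain ⟨K, hK, hrate⟩ := mainTheorem4_general W (zero_lt_one.trans hpD) hpS hpG F hGD hG
    ⟨uTrue, hSD huS⟩ huS hSp (hpDG.trans (min_le_right _ _)) hpR
    (hsR.trans (sub_le_self _ (mul_nonneg hε.le (sub_nonneg.2 ((one_le_div hpS).2 hSp)))))
    hc₁ hc₂ one_pos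
  exact ⟨K, hK, 1, one_pos, fun δ hδ hδ1 α hα₁ hα₂ vδ hvδ u hu =>
    hrate δ hδ hδ1 α hα₁ hα₂ vδ hvδ u (hu _)⟩
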